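/- Let $M\subset\mathbb{R}^2$ be a convex body, i.e. a nonempty compact convex set. Write $u_\theta=(\cos\theta,\sin\theta)$, let $R_\theta$ be the rotation of the plane about the origin by the angle $\theta$, let $h(\theta)=\max_{x\in M}u_\theta\cdot x$ be the support function of $M$, and let $$c_n=\frac{1}{2\pi}\int_{-\pi}^{\pi}h(\theta)e^{-in\theta}\,d\theta\qquad(n\in\mathbb{Z})$$ be its Fourier coefficients. Let $Ex(\theta,M)=|M-R_\theta M|$ be the excluded area function of $M$, where $M-R_\theta M=\{x-y:x\in M,\ y\in R_\theta M\}$ and $|\cdot|$ denotes area. Then for every $\theta\in\mathbb{R}$, $$Ex(\theta,M)=2\pi\sum_{n=-\infty}^{\infty}(1-n^2)\bigl(1+(-1)^n\cos(n\theta)\bigr)|c_n|^2,$$ where the series converges absolutely. -/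

import Mathlib

open scoped Pointwise

noncomputable section

namespace ExcludedArea

/-- The Euclidean plane. -/
abbrev Plane : Type := EuclideanSpace ℝ (Fin 2)

/-- The support function `h(u, M) = max_{x ∈ M} u · x`. For a convex body (nonempty and compact)
the supremum is attained. -/
def support (M : ConvexBody Plane) (u : Plane) : ℝ :=
  sSup ((fun x : Plane => inner ℝ u x) '' (M : Set Plane))

/-- The unit vector `u_θ = cos θ e₁ + sin θ e₂`. -/
def unitVec (θ : ℝ) : Plane := !₂[Real.cos θ, Real.sin θ]

/-- The support function as a function of the angle, `h(θ, M) = h(u_θ, M)`. -/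
def supportAngle (M : ConvexBody Plane) (θ : ℝ) : ℝ := support M (unitVec θ)

/-- The Fourier coefficients `c_n = (1 / 2π) ∫_{-π}^{π} h(θ, M) e^{-inθ} dθ` of the
support function. -/
def supportCoeff (M : ConvexBody Plane) (n : ℤ) : ℂ :=
  (1 / (2 * (Real.pi : ℂ))) *
    ∫ θ in (-Real.pi)..Real.pi,
      (supportAngle M θ : ℂ) * Complex.exp (-(Complex.I * (n : ℂ) * (θ : ℂ)))

/-- The rotation `R_θ` of the plane by the angle `θ` (counterclockwise, about the origin). -/
def rot (θ : ℝ) (x : Plane) : Plane :=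
  !₂[Real.cos θ * x 0 - Real.sin θ * x 1, Real.sin θ * x 0 + Real.cos θ * x 1]

/-- The excluded area of two planar bodies, `|M₁ - M₂|`, where
`M₁ - M₂ = {x - y : x ∈ M₁, y ∈ M₂}`. -/
def pairArea (M₁ M₂ : Set Plane) : ℝ := MeasureTheory.volume.real (M₁ - M₂)

/-- The excluded area function `Ex(θ, M) = |M - R_θ M|`. -/
def Ex (θ : ℝ) (M : ConvexBody Plane) : ℝ := pairArea (M : Set Plane) (rot θ '' (M : Set Plane))

end ExcludedArea

end

open Real Set Filter Topology MeasureTheory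

/-- `h` is the support function, in the angular variable, of the closed convex planar set `K`. -/
structure IsSupportFunction (K : Set (ℝ × ℝ)) (h : ℝ → ℝ) : Prop where
  le : ∀ x ∈ K, ∀ t, cos t * x.1 + sin t * x.2 ≤ h t
  exists_eq : ∀ t, ∃ x ∈ K, cos t * x.1 + sin t * x.2 = h t
  mem : ∀ p : ℝ × ℝ, (∀ t, cos t * p.1 + sin t * p.2 ≤ h t) → p ∈ K

namespace IsSupportFunction

variable {K : Set (ℝ × ℝ)} {h : ℝ → ℝ} {R : ℝ}

theorem isClosed (H : IsSupportFunction K h) : IsClosed K := by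
  have : K = ⋂ t, {p : ℝ × ℝ | cos t * p.1 + sin t * p.2 ≤ h t} := by
    ext p
    simp only [mem_iInter, mem_ofPred_eq]
    exact ⟨fun hp t => H.le p hp t, H.mem p⟩
  rw [this]
  exact isClosed_iInter fun t => isClosed_le (by fun_prop) continuous_const

theorem periodic (H : IsSupportFunction K h) : Function.Periodic h (2 * π) := by
  intro t
  apply le_antisymm
  · obtain ⟨x, hx, e⟩ := H.exists_eq (t + 2 * π)
    have := H.le x hx t
    rw [cos_add_two_pi, sin_add_two_pi] at e
    linarith
  · obtain ⟨x, hx, e⟩ := H.exists_eq t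
    have := H.le x hx (t + 2 * π)
    rw [cos_add_two_pi, sin_add_two_pi] at this
    linarith

theorem add_pi_nonneg (H : IsSupportFunction K h) (t : ℝ) : 0 ≤ h t + h (t + π) := by
  obtain ⟨x, hx, e⟩ := H.exists_eq t
  have := H.le x hx (t + π)
  rw [cos_add_pi, sin_add_pi] at this
  linarith

theorem mul_sin_sub_le (H : IsSupportFunction K h) {a b t : ℝ} (hat : a ≤ t) (htb : t ≤ b)
    (hab : b ≤ a + π) : h t * sin (b - a) ≤ h a * sin (b - t) + h b * sin (t - a) := by
  obtain ⟨x, hx, e⟩ := H.exists_eq t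
  have h1 := mul_le_mul_of_nonneg_right (H.le x hx a)
    (sin_nonneg_of_nonneg_of_le_pi (sub_nonneg.2 htb) (by linarith))
  have h2 := mul_le_mul_of_nonneg_right (H.le x hx b)
    (sin_nonneg_of_nonneg_of_le_pi (sub_nonneg.2 hat) (by linarith))
  have e1 : cos t * sin (b - a) = cos a * sin (b - t) + cos b * sin (t - a) := by
    simp only [sin_sub]; ring
  have e2 : sin t * sin (b - a) = sin a * sin (b - t) + sin b * sin (t - a) := by
    simp only [sin_sub]; ring
  rw [← e]
  linear_combination h1 + h2 + x.1 * e1 + x.2 * e2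

theorem abs_lt (H : IsSupportFunction K h) (hR : 0 < R) (hK : ∀ x ∈ K, x.1 ^ 2 + x.2 ^ 2 < R ^ 2)
    (t : ℝ) : |h t| < R := by
  obtain ⟨x, hx, e⟩ := H.exists_eq t
  apply abs_lt_of_sq_lt_sq _ hR.le
  have := hK x hx
  have : (cos t * x.1 + sin t * x.2) ^ 2 + (-sin t * x.1 + cos t * x.2) ^ 2 = x.1 ^ 2 + x.2 ^ 2 := by
    linear_combination (x.1 ^ 2 + x.2 ^ 2) * sin_sq_add_cos_sq t
  rw [← e]
  nlinarith [sq_nonneg (-sin t * x.1 + cos t * x.2)]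

theorem lipschitzWith (H : IsSupportFunction K h) (hR : 0 < R)
    (hK : ∀ x ∈ K, x.1 ^ 2 + x.2 ^ 2 < R ^ 2) : LipschitzWith (2 * R).toNNReal h := by
  apply LipschitzWith.of_le_add_mul'
  intro t s
  obtain ⟨x, hx, e⟩ := H.exists_eq t
  have h1 := H.le x hx s
  have hx' := hK x hx
  have a1 : |x.1| ≤ R := abs_le_of_sq_le_sq (by nlinarith) hR.le
  have a2 : |x.2| ≤ R := abs_le_of_sq_le_sq (by nlinarith) hR.le
  have c1 : |cos t - cos s| ≤ |t - s| := abs_cos_sub_cos_le t s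
  have c2 : |sin t - sin s| ≤ |t - s| := abs_sin_sub_sin_le t s
  have d1 : (cos t - cos s) * x.1 ≤ |t - s| * R := by
    refine (le_abs_self _).trans ?_
    rw [abs_mul]
    gcongr
  have d2 : (sin t - sin s) * x.2 ≤ |t - s| * R := by
    refine (le_abs_self _).trans ?_
    rw [abs_mul]
    gcongr
  rw [Real.dist_eq]
  linarith

/-- At a point of differentiability, the support set consists of the single point with
coordinates `(h t, h' t)` in the moving frame. -/
theorem deriv_eq (H : IsSupportFunction K h) {t : ℝ} (hd : DifferentiableAt ℝ h t) {x : ℝ × ℝ}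
    (hx : x ∈ K) (e : cos t * x.1 + sin t * x.2 = h t) :
    deriv h t = -sin t * x.1 + cos t * x.2 := by
  have hm : IsLocalMin (fun s => h s - (cos s * x.1 + sin s * x.2)) t := by
    refine Eventually.of_forall fun s => ?_
    have := H.le x hx s
    simp only
    linarith
  have := hm.hasDerivAt_eq_zero (hd.hasDerivAt.sub
    (((hasDerivAt_cos t).mul_const x.1).add ((hasDerivAt_sin t).mul_const x.2)))
  linarith

theorem sq_add_deriv_sq_lt (H : IsSupportFunction K h) (hK : ∀ x ∈ K, x.1 ^ 2 + x.2 ^ 2 < R ^ 2)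
    {t : ℝ} (hd : DifferentiableAt ℝ h t) : h t ^ 2 + deriv h t ^ 2 < R ^ 2 := by
  obtain ⟨x, hx, e⟩ := H.exists_eq t
  rw [H.deriv_eq hd hx e, ← e]
  have := hK x hx
  have : (cos t * x.1 + sin t * x.2) ^ 2 + (-sin t * x.1 + cos t * x.2) ^ 2 = x.1 ^ 2 + x.2 ^ 2 := by
    linear_combination (x.1 ^ 2 + x.2 ^ 2) * sin_sq_add_cos_sq t
  linarith

end IsSupportFunction

/-- The point with coordinates `(h t, s)` in the orthonormal frame rotated by `t`: a point of the
supporting line with normal direction `t`. -/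
noncomputable def supportLinePoint (h : ℝ → ℝ) (q : ℝ × ℝ) : ℝ × ℝ :=
  (h q.1 * cos q.1 - q.2 * sin q.1, h q.1 * sin q.1 + q.2 * cos q.1)

theorem cos_mul_supportLinePoint (h : ℝ → ℝ) (q : ℝ × ℝ) :
    cos q.1 * (supportLinePoint h q).1 + sin q.1 * (supportLinePoint h q).2 = h q.1 := by
  simp only [supportLinePoint]
  linear_combination h q.1 * sin_sq_add_cos_sq q.1

theorem neg_sin_mul_supportLinePoint (h : ℝ → ℝ) (q : ℝ × ℝ) :
    -sin q.1 * (supportLinePoint h q).1 + cos q.1 * (supportLinePoint h q).2 = q.2 := by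
  simp only [supportLinePoint]
  linear_combination q.2 * sin_sq_add_cos_sq q.1

theorem supportLinePoint_sq (h : ℝ → ℝ) (q : ℝ × ℝ) :
    (supportLinePoint h q).1 ^ 2 + (supportLinePoint h q).2 ^ 2 = h q.1 ^ 2 + q.2 ^ 2 := by
  simp only [supportLinePoint]
  linear_combination (h q.1 ^ 2 + q.2 ^ 2) * sin_sq_add_cos_sq q.1

theorem eq_supportLinePoint {h : ℝ → ℝ} {t : ℝ} {p : ℝ × ℝ}
    (e : cos t * p.1 + sin t * p.2 = h t) :
    supportLinePoint h (t, -sin t * p.1 + cos t * p.2) = p := by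
  simp only [supportLinePoint, ← e]
  ext
  · simp only
    linear_combination p.1 * sin_sq_add_cos_sq t
  · simp only
    linear_combination p.2 * sin_sq_add_cos_sq t

/-- Parameters of the open half-lines issuing from the contact points, cut off at radius `R`. -/
def tangentDomain (h : ℝ → ℝ) (R : ℝ) : Set (ℝ × ℝ) :=
  {q | q.1 ∈ Ioc (-π) π ∧ DifferentiableAt ℝ h q.1 ∧ deriv h q.1 < q.2 ∧
    h q.1 ^ 2 + q.2 ^ 2 < R ^ 2}

namespace IsSupportFunction

variable {K : Set (ℝ × ℝ)} {h : ℝ → ℝ} {R : ℝ}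

theorem supportLinePoint_notMem (H : IsSupportFunction K h) {q : ℝ × ℝ}
    (hd : DifferentiableAt ℝ h q.1) (hq : deriv h q.1 < q.2) : supportLinePoint h q ∉ K := by
  intro hx
  have := H.deriv_eq hd hx (cos_mul_supportLinePoint h q)
  rw [neg_sin_mul_supportLinePoint] at this
  exact hq.ne this

theorem hasDerivAt_sub {t : ℝ} (hd : DifferentiableAt ℝ h t) (p : ℝ × ℝ) :
    HasDerivAt (fun s => h s - (cos s * p.1 + sin s * p.2))
      (deriv h t - (-sin t * p.1 + cos t * p.2)) t :=
  hd.hasDerivAt.sub (((hasDerivAt_cos t).mul_const p.1).add ((hasDerivAt_sin t).mul_const p.2))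

/-- Two support lines through a common point, with directions less than a half-turn apart, cannot
both be left tangents. -/
theorem le_deriv_of_eq (H : IsSupportFunction K h) {a b : ℝ} (hab : a < b) (hba : b < a + π)
    {p : ℝ × ℝ} (ha : cos a * p.1 + sin a * p.2 = h a) (hb : cos b * p.1 + sin b * p.2 = h b)
    (hd : DifferentiableAt ℝ h b) : -sin b * p.1 + cos b * p.2 ≤ deriv h b := by
  have hs : 0 < sin (b - a) := sin_pos_of_pos_of_lt_pi (by linarith) (by linarith)
  have hneg : ∀ t ∈ Ioo a b, h t - (cos t * p.1 + sin t * p.2) ≤ 0 := by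
    intro t ht
    have h1 := H.mul_sin_sub_le ht.1.le ht.2.le hba.le
    have e1 : cos t * sin (b - a) = cos a * sin (b - t) + cos b * sin (t - a) := by
      simp only [sin_sub]; ring
    have e2 : sin t * sin (b - a) = sin a * sin (b - t) + sin b * sin (t - a) := by
      simp only [sin_sub]; ring
    rw [← ha, ← hb] at h1
    have : (h t - (cos t * p.1 + sin t * p.2)) * sin (b - a) ≤ 0 := by
      linear_combination h1 - p.1 * e1 - p.2 * e2
    exact nonpos_of_mul_nonpos_left this hs
  have hD := (hasDerivAt_sub hd p).hasDerivWithinAt (s := Iio b)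
  rw [hasDerivWithinAt_iff_tendsto_slope' (by simp)] at hD
  have : 0 ≤ deriv h b - (-sin b * p.1 + cos b * p.2) := by
    refine ge_of_tendsto hD ?_
    filter_upwards [Ioo_mem_nhdsLT hab] with t ht
    rw [slope_def_field]
    have := hneg t ht
    refine div_nonneg_of_nonpos ?_ (by linarith [ht.2])
    linarith
  linarith

theorem injOn_supportLinePoint (H : IsSupportFunction K h) :
    InjOn (supportLinePoint h) (tangentDomain h R) := by
  have key : ∀ q ∈ tangentDomain h R, ∀ q' ∈ tangentDomain h R,
      supportLinePoint h q = supportLinePoint h q' → ¬ q.1 < q'.1 := by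
    rintro q ⟨hq1, hq2, hq3, -⟩ q' ⟨hq1', hq2', hq3', -⟩ e hlt
    set p := supportLinePoint h q with hp
    have a := cos_mul_supportLinePoint h q
    have a' := neg_sin_mul_supportLinePoint h q
    have b := cos_mul_supportLinePoint h q'
    have b' := neg_sin_mul_supportLinePoint h q'
    rw [← e] at b b'
    rw [← hp] at a a'
    rcases lt_trichotomy q'.1 (q.1 + π) with hc | hc | hc
    · have := H.le_deriv_of_eq hlt hc a b hq2'
      linarith
    · have hm : IsLocalMin (fun s => (h s - (cos s * p.1 + sin s * p.2)) +
          (h (s + π) - (cos (s + π) * p.1 + sin (s + π) * p.2))) q.1 := by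
        refine Eventually.of_forall fun s => ?_
        have := H.add_pi_nonneg s
        simp only [← hc, a, b]
        rw [cos_add_pi, sin_add_pi]
        linarith
      have d := hasDerivAt_sub hq2' p
      rw [hc] at d
      have := hm.hasDerivAt_eq_zero ((hasDerivAt_sub hq2 p).add (d.comp_add_const q.1 π))
      rw [← hc] at this
      linarith
    · have := H.le_deriv_of_eq (a := q'.1 - 2 * π) (b := q.1)
        (by linarith [hq1.1, hq1'.2]) (by linarith) (p := p)
        (by rw [cos_sub_two_pi, sin_sub_two_pi, b, H.periodic.sub_eq]) a hq2
      linarith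
  intro q hq q' hq' e
  have e1 : q.1 = q'.1 :=
    le_antisymm (not_lt.1 (key q' hq' q hq e.symm)) (not_lt.1 (key q hq q' hq' e))
  refine Prod.ext e1 ?_
  have a' := neg_sin_mul_supportLinePoint h q
  have b' := neg_sin_mul_supportLinePoint h q'
  rw [← a', ← b', e, e1]

theorem image_tangentDomain_subset (H : IsSupportFunction K h) :
    supportLinePoint h '' tangentDomain h R ⊆ {p | p.1 ^ 2 + p.2 ^ 2 < R ^ 2} \ K := by
  rintro _ ⟨q, ⟨-, hd, hlt, hR⟩, rfl⟩
  refine ⟨?_, H.supportLinePoint_notMem hd hlt⟩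
  rwa [mem_ofPred_eq, supportLinePoint_sq]

/-- Through a point outside `K` there is a support line at which the signed distance changes sign
from negative to positive. -/
theorem exists_supportLine (H : IsSupportFunction K h) (hc : Continuous h) {p : ℝ × ℝ}
    (hp : p ∉ K) : ∃ t ∈ Ioc (-π) π, cos t * p.1 + sin t * p.2 = h t ∧
      ∃ ε > 0, ∀ s ∈ Ioo t (t + ε), h s < cos s * p.1 + sin s * p.2 := by
  set f : ℝ → ℝ := fun t => cos t * p.1 + sin t * p.2 - h t with hf
  have fc : Continuous f := by fun_prop
  have fp : Function.Periodic f (2 * π) := by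
    intro t
    simp only [hf, cos_add_two_pi, sin_add_two_pi, H.periodic t]
  obtain ⟨b, hb⟩ : ∃ b, 0 < f b := by
    by_contra! hcon
    exact hp (H.mem p fun t => by linarith [hcon t])
  have ha : f (b - π) < 0 := by
    have h1 := H.add_pi_nonneg (b - π)
    simp only [sub_add_cancel] at h1
    simp only [hf] at hb ⊢
    rw [cos_sub_pi, sin_sub_pi]
    linarith
  set Z : Set ℝ := Icc (b - π) b ∩ {t | f t ≤ 0} with hZ
  have Zc : IsCompact Z := isCompact_Icc.inter_right (isClosed_le fc continuous_const)
  have Zne : Z.Nonempty := ⟨b - π, ⟨le_rfl, by linarith [pi_pos]⟩, ha.le⟩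
  obtain ⟨t, ⟨⟨ht1, ht2⟩, ht0⟩, htm⟩ := Zc.exists_isGreatest Zne
  simp only [mem_ofPred_eq] at ht0
  have htb : t < b := lt_of_le_of_ne ht2 (by rintro rfl; linarith)
  have hpos : ∀ s ∈ Ioo t b, 0 < f s := by
    intro s hs
    by_contra! hcon
    exact absurd (htm ⟨⟨by linarith [hs.1], hs.2.le⟩, hcon⟩) (not_le.2 hs.1)
  have ht0' : f t = 0 := by
    refine le_antisymm ht0 ?_
    refine ge_of_tendsto (fc.continuousWithinAt (s := Ioi t) (x := t)) ?_
    filter_upwards [Ioo_mem_nhdsGT htb] with s hs using (hpos s hs).le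
  obtain ⟨n, hn⟩ : ∃ n : ℤ, toIocMod two_pi_pos (-π) t = t - n * (2 * π) :=
    ⟨toIocDiv two_pi_pos (-π) t, by rw [toIocMod, zsmul_eq_mul]⟩
  have hmem := toIocMod_mem_Ioc two_pi_pos (-π) t
  rw [hn, show -π + 2 * π = π by ring] at hmem
  refine ⟨_, hmem, ?_, b - t, by linarith, ?_⟩
  · have := fp.sub_int_mul_eq n (x := t)
    rw [ht0'] at this
    simp only [hf] at this
    linarith
  · intro s hs
    have h1 := hpos (s + n * (2 * π)) ⟨by linarith [hs.1], by linarith [hs.2]⟩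
    have h2 := fp.int_mul n s
    rw [h2] at h1
    simp only [hf] at h1
    linarith

theorem subset_image_tangentDomain (H : IsSupportFunction K h) (hc : Continuous h) (hR : 0 < R) :
    {p | p.1 ^ 2 + p.2 ^ 2 < R ^ 2} \ K ⊆ supportLinePoint h '' tangentDomain h R ∪
      supportLinePoint h '' ({t | ¬ DifferentiableAt ℝ h t} ×ˢ Icc (-R) R) := by
  rintro p ⟨hpR, hpK⟩
  simp only [mem_ofPred_eq] at hpR
  obtain ⟨t, ht, e, ε, hε, hpos⟩ := H.exists_supportLine hc hpK
  have hsq : h t ^ 2 + (-sin t * p.1 + cos t * p.2) ^ 2 < R ^ 2 := by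
    have := supportLinePoint_sq h (t, -sin t * p.1 + cos t * p.2)
    rw [eq_supportLinePoint e] at this
    simp only at this
    linarith
  by_cases hd : DifferentiableAt ℝ h t
  · left
    refine ⟨_, ⟨ht, hd, ?_, hsq⟩, eq_supportLinePoint e⟩
    simp only
    refine lt_of_le_of_ne ?_ ?_
    · have hD := (hasDerivAt_sub hd p).hasDerivWithinAt (s := Ioi t)
      rw [hasDerivWithinAt_iff_tendsto_slope' (by simp)] at hD
      have : deriv h t - (-sin t * p.1 + cos t * p.2) ≤ 0 := by
        refine le_of_tendsto hD ?_
        filter_upwards [Ioo_mem_nhdsGT (show t < t + ε by linarith)] with s hs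
        rw [slope_def_field]
        have := hpos s hs
        refine div_nonpos_of_nonpos_of_nonneg ?_ (by linarith [hs.1])
        linarith
      linarith
    · intro he
      obtain ⟨x, hx, ex⟩ := H.exists_eq t
      have h1 := H.deriv_eq hd hx ex
      have h2 := eq_supportLinePoint ex
      rw [← h1, he, eq_supportLinePoint e] at h2
      exact hpK (h2 ▸ hx)
  · right
    refine ⟨_, ⟨by simpa using hd, ?_⟩, eq_supportLinePoint e⟩
    exact abs_le.1 (abs_le_of_sq_le_sq (by nlinarith [sq_nonneg (h t)]) hR.le)

end IsSupportFunction

/-- The derivative of `supportLinePoint h` at a point where `h` has derivative `h'`. -/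
noncomputable def fderivSupportLinePoint (h : ℝ → ℝ) (q : ℝ × ℝ) : ℝ × ℝ →L[ℝ] ℝ × ℝ :=
  (Matrix.toLin (.finTwoProd ℝ) (.finTwoProd ℝ)
    !![deriv h q.1 * cos q.1 - h q.1 * sin q.1 - q.2 * cos q.1, -sin q.1;
      deriv h q.1 * sin q.1 + h q.1 * cos q.1 - q.2 * sin q.1, cos q.1]).toContinuousLinearMap

theorem det_fderivSupportLinePoint (h : ℝ → ℝ) (q : ℝ × ℝ) :
    (fderivSupportLinePoint h q).det = deriv h q.1 - q.2 := by
  conv_lhs => rw [fderivSupportLinePoint, ContinuousLinearMap.det,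
    LinearMap.coe_toContinuousLinearMap, LinearMap.det_toLin, Matrix.det_fin_two_of]
  linear_combination (deriv h q.1 - q.2) * sin_sq_add_cos_sq q.1

theorem hasFDerivAt_supportLinePoint {h : ℝ → ℝ} {q : ℝ × ℝ} (hd : DifferentiableAt ℝ h q.1) :
    HasFDerivAt (supportLinePoint h) (fderivSupportLinePoint h q) q := by
  unfold fderivSupportLinePoint
  rw [Matrix.toLin_finTwoProd_toContinuousLinearMap]
  have hh := hd.hasDerivAt.comp_hasFDerivAt q (hasFDerivAt_fst (𝕜 := ℝ))
  have hcos := (hasDerivAt_cos q.1).comp_hasFDerivAt q (hasFDerivAt_fst (𝕜 := ℝ))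
  have hsin := (hasDerivAt_sin q.1).comp_hasFDerivAt q (hasFDerivAt_fst (𝕜 := ℝ))
  have hs := hasFDerivAt_snd (𝕜 := ℝ) (p := q)
  refine (((hh.mul hcos).sub (hs.mul hsin)).prodMk ((hh.mul hsin).add (hs.mul hcos))).congr_fderiv ?_
  ext <;> simp <;> ring

theorem measurableSet_tangentDomain {h : ℝ → ℝ} (hc : Continuous h) (R : ℝ) :
    MeasurableSet (tangentDomain h R) := by
  have h1 : MeasurableSet {q : ℝ × ℝ | q.1 ∈ Ioc (-π) π} := measurable_fst measurableSet_Ioc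
  have h2 : MeasurableSet {q : ℝ × ℝ | DifferentiableAt ℝ h q.1} :=
    measurable_fst (measurableSet_of_differentiableAt ℝ h)
  have h3 : MeasurableSet {q : ℝ × ℝ | deriv h q.1 < q.2} :=
    measurableSet_lt ((measurable_deriv h).comp measurable_fst) measurable_snd
  have h4 : MeasurableSet {q : ℝ × ℝ | h q.1 ^ 2 + q.2 ^ 2 < R ^ 2} :=
    measurableSet_lt (by fun_prop) measurable_const
  exact h1.inter (h2.inter (h3.inter h4))

theorem lipschitzOnWith_supportLinePoint {h : ℝ → ℝ} {C : NNReal} {R : ℝ} (hL : LipschitzWith C h)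
    (hB : ∀ t, |h t| ≤ R) (hR : 0 ≤ R) :
    LipschitzOnWith (C + 2 * R.toNNReal + 1) (supportLinePoint h) (univ ×ˢ Icc (-R) R) := by
  apply LipschitzOnWith.of_dist_le_mul
  rintro ⟨t, s⟩ ⟨-, hs⟩ ⟨t', s'⟩ -
  simp only [mem_Icc, ← abs_le] at hs
  have hR' : (R.toNNReal : ℝ) = R := Real.coe_toNNReal R hR
  have bt : |t - t'| ≤ dist (t, s) (t', s') := by
    rw [← Real.dist_eq]; exact le_max_left _ _
  have bs : |s - s'| ≤ dist (t, s) (t', s') := by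
    rw [← Real.dist_eq]; exact le_max_right _ _
  have bh : |h t - h t'| ≤ C * |t - t'| := by
    simpa [Real.dist_eq] using hL.dist_le_mul t t'
  have key : ∀ a b a' b' : ℝ, |a| ≤ 1 → |b'| ≤ 1 → |a - a'| ≤ |t - t'| → |b - b'| ≤ |t - t'| →
      |(h t - h t') * a + h t' * (a - a') + s * (b - b') + (s - s') * b'| ≤
        (C + 2 * R + 1) * dist (t, s) (t', s') := by
    intro a b a' b' ha hb' haa hbb
    calc _ ≤ |(h t - h t') * a| + |h t' * (a - a')| + |s * (b - b')| + |(s - s') * b'| := by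
          refine (abs_add_le _ _).trans (add_le_add_left ((abs_add_le _ _).trans
            (add_le_add_left (abs_add_le _ _) _)) _)
      _ = |h t - h t'| * |a| + |h t'| * |a - a'| + |s| * |b - b'| + |s - s'| * |b'| := by
          simp only [abs_mul]
      _ ≤ (C * |t - t'|) * 1 + R * |t - t'| + R * |t - t'| + |s - s'| * 1 := by
          gcongr
          exact hB t'
      _ ≤ (C * dist (t, s) (t', s')) * 1 + R * dist (t, s) (t', s') + R * dist (t, s) (t', s') +
            dist (t, s) (t', s') * 1 := by gcongr
      _ = _ := by ring
  have e : ((C + 2 * R.toNNReal + 1 : NNReal) : ℝ) = C + 2 * R + 1 := by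
    push_cast [hR']; ring
  rw [e, Prod.dist_eq]
  refine max_le ?_ ?_
  · rw [Real.dist_eq]
    refine le_trans (le_of_eq ?_) (key (cos t) (-sin t) (cos t') (-sin t') (abs_cos_le_one t)
      (by rw [abs_neg]; exact abs_sin_le_one t') (abs_cos_sub_cos_le t t') ?_)
    · simp only [supportLinePoint]
      congr 1
      ring
    · rw [← abs_neg]
      refine le_trans (le_of_eq ?_) (abs_sin_sub_sin_le t t')
      congr 1
      ring
  · rw [Real.dist_eq]
    refine le_trans (le_of_eq ?_) (key (sin t) (cos t) (sin t') (cos t') (abs_sin_le_one t)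
      (abs_cos_le_one t') (abs_sin_sub_sin_le t t') (abs_cos_sub_cos_le t t'))
    simp only [supportLinePoint]
    congr 1
    ring

theorem volume_image_supportLinePoint_eq_zero {h : ℝ → ℝ} {C : NNReal} {R : ℝ}
    (hL : LipschitzWith C h) (hB : ∀ t, |h t| ≤ R) (hR : 0 ≤ R) :
    volume (supportLinePoint h '' ({t | ¬ DifferentiableAt ℝ h t} ×ˢ Icc (-R) R)) = 0 := by
  rw [← hausdorffMeasure_prod_real]
  have h0 : volume ({t | ¬ DifferentiableAt ℝ h t} ×ˢ Icc (-R) R : Set (ℝ × ℝ)) = 0 := by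
    rw [Measure.volume_eq_prod, Measure.prod_prod, ae_iff.1 hL.ae_differentiableAt_real, zero_mul]
  have h1 := ((lipschitzOnWith_supportLinePoint hL hB hR).mono
    (prod_mono_left (subset_univ {t | ¬ DifferentiableAt ℝ h t}))).hausdorffMeasure_image_le
    (d := 2) (by norm_num)
  rw [hausdorffMeasure_prod_real, h0, mul_zero] at h1
  rw [hausdorffMeasure_prod_real]
  exact nonpos_iff_eq_zero.1 h1

theorem setLIntegral_Ioo_ofReal_sub {a b : ℝ} (hab : a ≤ b) :
    ∫⁻ s in Ioo a b, ENNReal.ofReal (s - a) = ENNReal.ofReal ((b - a) ^ 2 / 2) := by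
  rw [← ofReal_integral_eq_lintegral_ofReal]
  · rw [← integral_Ioc_eq_integral_Ioo, ← intervalIntegral.integral_of_le hab]
    simp
    congr 1
    ring
  · exact ((continuous_id.sub continuous_const).continuousOn.integrableOn_Icc).mono_set
      Ioo_subset_Icc_self
  · filter_upwards [ae_restrict_mem measurableSet_Ioo] with s hs
    simpa using hs.1.le

theorem setLIntegral_tangentDomain {h : ℝ → ℝ} {R : ℝ} (hc : Continuous h)
    (hR : ∀ t, DifferentiableAt ℝ h t → h t ^ 2 + deriv h t ^ 2 < R ^ 2)
    (hd : ∀ᵐ t, DifferentiableAt ℝ h t) :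
    ∫⁻ q in tangentDomain h R, ENNReal.ofReal |(fderivSupportLinePoint h q).det| =
      ∫⁻ t in Ioc (-π) π, ENNReal.ofReal ((√(R ^ 2 - h t ^ 2) - deriv h t) ^ 2 / 2) := by
  have hm := measurableSet_tangentDomain hc R
  have hmeas : Measurable fun q : ℝ × ℝ => ENNReal.ofReal |deriv h q.1 - q.2| :=
    (((measurable_deriv h).comp measurable_fst).sub measurable_snd).abs.ennreal_ofReal
  simp only [det_fderivSupportLinePoint]
  rw [← lintegral_indicator hm, Measure.volume_eq_prod,
    lintegral_prod _ (hmeas.indicator hm).aemeasurable, ← lintegral_indicator measurableSet_Ioc]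
  refine lintegral_congr_ae ?_
  filter_upwards [hd] with t ht
  by_cases hI : t ∈ Ioc (-π) π
  · have hlt : deriv h t < √(R ^ 2 - h t ^ 2) := Real.lt_sqrt_of_sq_lt (by linarith [hR t ht])
    rw [indicator_of_mem hI, ← setLIntegral_Ioo_ofReal_sub hlt.le,
      ← lintegral_indicator measurableSet_Ioo]
    refine lintegral_congr fun s => ?_
    by_cases hs : s ∈ Ioo (deriv h t) (√(R ^ 2 - h t ^ 2))
    · have h1 : -√(R ^ 2 - h t ^ 2) < s :=
        lt_trans (Real.neg_sqrt_lt_of_sq_lt (by linarith [hR t ht])) hs.1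
      have h2 : s ^ 2 < R ^ 2 - h t ^ 2 := Real.sq_lt.2 ⟨h1, hs.2⟩
      have : (t, s) ∈ tangentDomain h R := ⟨hI, ht, hs.1, by simp only; linarith⟩
      rw [indicator_of_mem hs, indicator_of_mem this, abs_sub_comm,
        abs_of_pos (sub_pos.2 hs.1)]
    · rw [indicator_of_notMem hs, indicator_of_notMem]
      rintro ⟨-, -, h3, h4⟩
      simp only at h3 h4
      exact hs ⟨h3, Real.lt_sqrt_of_sq_lt (by linarith)⟩
  · rw [indicator_of_notMem hI]
    refine (lintegral_congr fun s => ?_).trans lintegral_zero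
    rw [indicator_of_notMem]
    exact fun hq => hI hq.1

theorem measurePreserving_coordProd :
    MeasurePreserving (fun x : EuclideanSpace ℝ (Fin 2) => (x 0, x 1)) volume volume :=
  (volume_preserving_finTwoArrow ℝ).comp (PiLp.volume_preserving_ofLp (Fin 2))

theorem volume_disc {R : ℝ} (hR : 0 ≤ R) :
    volume {p : ℝ × ℝ | p.1 ^ 2 + p.2 ^ 2 < R ^ 2} = ENNReal.ofReal (π * R ^ 2) := by
  have h1 : MeasurableSet {p : ℝ × ℝ | p.1 ^ 2 + p.2 ^ 2 < R ^ 2} :=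
    measurableSet_lt (by fun_prop) measurable_const
  rw [← measurePreserving_coordProd.measure_preimage h1.nullMeasurableSet, mul_comm π,
    ENNReal.ofReal_mul (by positivity), ENNReal.ofReal_pow hR,
    ← EuclideanSpace.volume_ball_fin_two 0 R]
  congr 1
  ext x
  simp only [mem_preimage, mem_ofPred_eq, mem_ball_zero_iff, EuclideanSpace.norm_eq,
    Fin.sum_univ_two, Real.norm_eq_abs, sq_abs]
  rw [Real.sqrt_lt (by positivity) hR]

namespace IsSupportFunction

variable {K : Set (ℝ × ℝ)} {h : ℝ → ℝ} {R : ℝ}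

theorem volume_disc_diff (H : IsSupportFunction K h) (hR : 0 < R)
    (hK : ∀ x ∈ K, x.1 ^ 2 + x.2 ^ 2 < R ^ 2) :
    volume ({p : ℝ × ℝ | p.1 ^ 2 + p.2 ^ 2 < R ^ 2} \ K) =
      ∫⁻ t in Ioc (-π) π, ENNReal.ofReal ((√(R ^ 2 - h t ^ 2) - deriv h t) ^ 2 / 2) := by
  have hL := H.lipschitzWith hR hK
  rw [← setLIntegral_tangentDomain hL.continuous (fun t ht => H.sq_add_deriv_sq_lt hK ht)
    hL.ae_differentiableAt_real, lintegral_abs_det_fderiv_eq_addHaar_image volume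
    (measurableSet_tangentDomain hL.continuous R)
    (fun q hq => (hasFDerivAt_supportLinePoint hq.2.1).hasFDerivWithinAt)
    H.injOn_supportLinePoint]
  refine le_antisymm ?_ (measure_mono H.image_tangentDomain_subset)
  refine (measure_mono (H.subset_image_tangentDomain hL.continuous hR)).trans
    ((measure_union_le _ _).trans ?_)
  rw [volume_image_supportLinePoint_eq_zero hL (fun t => (H.abs_lt hR hK t).le) hR.le, add_zero]

theorem intervalIntegrable_deriv_sq (H : IsSupportFunction K h) (hR : 0 < R)
    (hK : ∀ x ∈ K, x.1 ^ 2 + x.2 ^ 2 < R ^ 2) (a b : ℝ) :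
    IntervalIntegrable (fun t => deriv h t ^ 2) volume a b := by
  refine (intervalIntegrable_const (c := (2 * R) ^ 2)).mono_fun
    ((measurable_deriv h).pow_const 2).aestronglyMeasurable (Eventually.of_forall fun t => ?_)
  have h1 := norm_deriv_le_of_lipschitz (H.lipschitzWith hR hK) (x₀ := t)
  rw [Real.coe_toNNReal _ (by positivity)] at h1
  simp only [norm_pow]
  rw [Real.norm_of_nonneg (show 0 ≤ 2 * R by positivity)]
  gcongr

theorem integral_sqrt_mul_deriv (H : IsSupportFunction K h) (hR : 0 < R)
    (hK : ∀ x ∈ K, x.1 ^ 2 + x.2 ^ 2 < R ^ 2) :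
    ∫ t in (-π)..π, √(R ^ 2 - h t ^ 2) * deriv h t = 0 := by
  have hL := H.lipschitzWith hR hK
  set G : ℝ → ℝ := fun y => ∫ u in (0 : ℝ)..y, √(R ^ 2 - u ^ 2) with hG
  have hGd : ∀ y, HasDerivAt G (√(R ^ 2 - y ^ 2)) y := fun y =>
    (by fun_prop : Continuous fun u : ℝ => √(R ^ 2 - u ^ 2)).integral_hasStrictDerivAt 0 y
      |>.hasDerivAt
  have hGL : LipschitzWith R.toNNReal G := by
    refine lipschitzWith_of_nnnorm_deriv_le (fun y => (hGd y).differentiableAt) fun y => ?_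
    rw [(hGd y).deriv, ← NNReal.coe_le_coe, coe_nnnorm, Real.coe_toNNReal _ hR.le,
      Real.norm_of_nonneg (sqrt_nonneg _)]
    exact Real.sqrt_le_iff.2 ⟨hR.le, by nlinarith [sq_nonneg y]⟩
  have hAC := ((hGL.comp hL).lipschitzOnWith
    (s := uIcc (-π) π)).absolutelyContinuousOnInterval.integral_deriv_eq_sub
  have hper : h π = h (-π) := by
    rw [← H.periodic (-π)]; congr 1; ring
  simp only [Function.comp_apply, hper, sub_self] at hAC
  rw [← hAC]
  refine intervalIntegral.integral_congr_ae ?_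
  filter_upwards [hL.ae_differentiableAt_real] with t ht _
  exact ((hGd (h t)).comp t ht.hasDerivAt).deriv.symm

/-- Cauchy's area formula `|K| = ½ ∫ (h² - h'²)` in terms of the support function. -/
theorem area_eq (H : IsSupportFunction K h) (hR : 0 < R)
    (hK : ∀ x ∈ K, x.1 ^ 2 + x.2 ^ 2 < R ^ 2) :
    volume.real K = 1 / 2 * ((∫ t in (-π)..π, h t ^ 2) - ∫ t in (-π)..π, deriv h t ^ 2) := by
  have hL := H.lipschitzWith hR hK
  have hc := hL.continuous
  have i1 : IntervalIntegrable (fun t => h t ^ 2) volume (-π) π :=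
    (hc.pow 2).intervalIntegrable _ _
  have i2 := H.intervalIntegrable_deriv_sq hR hK (-π) π
  have i3 : IntervalIntegrable (fun t => √(R ^ 2 - h t ^ 2) * deriv h t) volume (-π) π :=
    ((hL.lipschitzOnWith
      (s := uIcc (-π) π)).absolutelyContinuousOnInterval.intervalIntegrable_deriv).continuousOn_mul
      (by fun_prop)
  have hle : -π ≤ π := by linarith [pi_pos]
  have e1 : ∀ t, (√(R ^ 2 - h t ^ 2) - deriv h t) ^ 2 / 2 =
      (1 / 2 * R ^ 2 - 1 / 2 * h t ^ 2) - √(R ^ 2 - h t ^ 2) * deriv h t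
        + 1 / 2 * deriv h t ^ 2 := by
    intro t
    have h1 := _root_.abs_lt.1 (H.abs_lt hR hK t)
    have := Real.sq_sqrt (show 0 ≤ R ^ 2 - h t ^ 2 by nlinarith)
    linear_combination this / 2
  have ic : IntervalIntegrable (fun _ : ℝ => 1 / 2 * R ^ 2) volume (-π) π :=
    intervalIntegrable_const
  have hint : IntervalIntegrable (fun t => (√(R ^ 2 - h t ^ 2) - deriv h t) ^ 2 / 2)
      volume (-π) π := by
    simp only [e1]
    exact ((ic.sub (i1.const_mul _)).sub i3).add (i2.const_mul _)
  have hval : ∫ t in (-π)..π, (√(R ^ 2 - h t ^ 2) - deriv h t) ^ 2 / 2 =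
      π * R ^ 2 - 1 / 2 * ((∫ t in (-π)..π, h t ^ 2) - ∫ t in (-π)..π, deriv h t ^ 2) := by
    simp only [e1]
    rw [intervalIntegral.integral_add ((ic.sub (i1.const_mul _)).sub i3) (i2.const_mul _),
      intervalIntegral.integral_sub (ic.sub (i1.const_mul _)) i3,
      intervalIntegral.integral_sub ic (i1.const_mul _), H.integral_sqrt_mul_deriv hR hK,
      intervalIntegral.integral_const_mul (1 / 2 : ℝ) (fun t => h t ^ 2),
      intervalIntegral.integral_const_mul (1 / 2 : ℝ) (fun t => deriv h t ^ 2), intervalIntegral.integral_const, smul_eq_mul]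
    ring
  have hsub : K ⊆ {p : ℝ × ℝ | p.1 ^ 2 + p.2 ^ 2 < R ^ 2} := hK
  have hD := H.volume_disc_diff hR hK
  have hdisc := volume_disc hR.le
  rw [intervalIntegral.integral_of_le hle] at hval
  rw [← ofReal_integral_eq_lintegral_ofReal ((intervalIntegrable_iff_integrableOn_Ioc_of_le hle).1
    hint) (Eventually.of_forall fun t => by positivity), hval] at hD
  have hfin : volume {p : ℝ × ℝ | p.1 ^ 2 + p.2 ^ 2 < R ^ 2} ≠ ⊤ := by
    rw [hdisc]; exact ENNReal.ofReal_ne_top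
  have hdiff := measureReal_sdiff hsub H.isClosed.measurableSet hfin
  have hnn : 0 ≤ π * R ^ 2 - 1 / 2 * ((∫ t in (-π)..π, h t ^ 2) - ∫ t in (-π)..π, deriv h t ^ 2) := by
    rw [← hval]
    exact integral_nonneg fun t => by positivity
  rw [measureReal_def, hD, measureReal_def, hdisc, ENNReal.toReal_ofReal hnn,
    ENNReal.toReal_ofReal (by positivity)] at hdiff
  linarith

end IsSupportFunction

/-- Fourier coefficients of a `2π`-periodic real function. -/
noncomputable def angleCoeff (f : ℝ → ℝ) (n : ℤ) : ℂ :=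
  (1 / (2 * (π : ℂ))) * ∫ t in (-π)..π, (f t : ℂ) * Complex.exp (-(Complex.I * (n : ℂ) * (t : ℂ)))

theorem angleCoeff_eq_fourierCoeffOn (f : ℝ → ℝ) (n : ℤ) :
    angleCoeff f n = fourierCoeffOn (neg_lt_self pi_pos) (fun t => (f t : ℂ)) n := by
  rw [fourierCoeffOn_eq_integral, angleCoeff, Complex.real_smul]
  congr 1
  · push_cast; ring
  · refine intervalIntegral.integral_congr fun t _ => ?_
    simp only [fourier_coe_apply, smul_eq_mul]
    rw [mul_comm]
    congr 2
    have : (π : ℂ) ≠ 0 := by exact_mod_cast pi_ne_zero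
    push_cast
    field_simp
    ring

theorem hasSum_sq_angleCoeff {f : ℝ → ℝ} (hf : Measurable f) {C : ℝ} (hC : ∀ t, |f t| ≤ C) :
    HasSum (fun n : ℤ => ‖angleCoeff f n‖ ^ 2) (1 / (2 * π) * ∫ t in (-π)..π, f t ^ 2) := by
  have hL : MemLp (fun t => (f t : ℂ)) 2 (volume.restrict (Ioc (-π) π)) := by
    refine MemLp.of_bound (Complex.measurable_ofReal.comp hf).aestronglyMeasurable C ?_
    exact Eventually.of_forall fun t => by simpa using hC t
  have := hasSum_sq_fourierCoeffOn (neg_lt_self pi_pos) hL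
  simp only [← angleCoeff_eq_fourierCoeffOn, Complex.norm_real, Real.norm_eq_abs, sq_abs] at this
  convert this using 1
  rw [smul_eq_mul]
  congr 1
  rw [one_div]
  congr 1
  ring

theorem angleCoeff_eq_cos_sub_sin {f : ℝ → ℝ} (hf : IntervalIntegrable f volume (-π) π) (n : ℤ) :
    angleCoeff f n = (1 / (2 * (π : ℂ))) * (((∫ t in (-π)..π, cos (n * t) * f t : ℝ) : ℂ) -
      Complex.I * ((∫ t in (-π)..π, sin (n * t) * f t : ℝ) : ℂ)) := by
  have hc : IntervalIntegrable (fun t => cos (n * t) * f t) volume (-π) π :=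
    hf.continuousOn_mul (by fun_prop)
  have hs : IntervalIntegrable (fun t => sin (n * t) * f t) volume (-π) π :=
    hf.continuousOn_mul (by fun_prop)
  have hc' : IntervalIntegrable (fun t => ((cos (n * t) * f t : ℝ) : ℂ)) volume (-π) π :=
    ⟨hc.1.ofReal, hc.2.ofReal⟩
  have hs' : IntervalIntegrable (fun t => ((sin (n * t) * f t : ℝ) : ℂ)) volume (-π) π :=
    ⟨hs.1.ofReal, hs.2.ofReal⟩
  rw [angleCoeff, ← intervalIntegral.integral_ofReal, ← intervalIntegral.integral_ofReal,
    ← intervalIntegral.integral_const_mul Complex.I,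
    ← intervalIntegral.integral_sub hc' (hs'.const_mul _)]
  congr 1
  refine intervalIntegral.integral_congr fun t _ => ?_
  rw [show -(Complex.I * (n : ℂ) * (t : ℂ)) = ((-(n * t) : ℝ) : ℂ) * Complex.I by push_cast; ring,
    Complex.exp_mul_I, ← Complex.ofReal_cos, ← Complex.ofReal_sin, cos_neg, sin_neg]
  push_cast
  ring

theorem angleCoeff_deriv {f : ℝ → ℝ} {C : NNReal} (hf : LipschitzWith C f)
    (hp : f π = f (-π)) (n : ℤ) : angleCoeff (deriv f) n = Complex.I * n * angleCoeff f n := by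
  have hac := (hf.lipschitzOnWith (s := uIcc (-π) π)).absolutelyContinuousOnInterval
  have lin : LipschitzWith ‖(n : ℝ)‖₊ fun t : ℝ => (n : ℝ) * t :=
    LipschitzWith.of_dist_le_mul fun x y => by
      rw [Real.dist_eq, ← mul_sub, abs_mul, Real.dist_eq, coe_nnnorm, Real.norm_eq_abs]
  have hcos := ((lipschitzWith_cos.comp lin).lipschitzOnWith
    (s := uIcc (-π) π)).absolutelyContinuousOnInterval
  have hsin := ((lipschitzWith_sin.comp lin).lipschitzOnWith
    (s := uIcc (-π) π)).absolutelyContinuousOnInterval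
  have e1 := hcos.integral_mul_deriv_eq_deriv_mul hac
  have e2 := hsin.integral_mul_deriv_eq_deriv_mul hac
  have d1 : deriv (cos ∘ fun t : ℝ => (n : ℝ) * t) = fun t => -(n : ℝ) * sin (n * t) := by
    ext t
    have := ((hasDerivAt_id t).const_mul (n : ℝ)).cos
    simp only [id] at this
    rw [Function.comp_def, this.deriv]
    ring
  have d2 : deriv (sin ∘ fun t : ℝ => (n : ℝ) * t) = fun t => (n : ℝ) * cos (n * t) := by
    ext t
    have := ((hasDerivAt_id t).const_mul (n : ℝ)).sin
    simp only [id] at this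
    rw [Function.comp_def, this.deriv]
    ring
  simp only [d1, d2, Function.comp_apply, hp, mul_neg, cos_neg, sin_neg, sub_self, neg_mul,
    intervalIntegral.integral_neg, mul_assoc, intervalIntegral.integral_const_mul] at e1 e2
  rw [Real.sin_int_mul_pi] at e2
  rw [angleCoeff_eq_cos_sub_sin hac.intervalIntegrable_deriv,
    angleCoeff_eq_cos_sub_sin (hf.continuous.intervalIntegrable _ _), e1, e2]
  push_cast
  linear_combination ((1 / (2 * (π : ℂ))) * n *
    ((∫ t in (-π)..π, sin (n * t) * f t : ℝ) : ℂ)) * Complex.I_sq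

theorem IsSupportFunction.hasSum_area {K : Set (ℝ × ℝ)} {h : ℝ → ℝ} {R : ℝ}
    (H : IsSupportFunction K h) (hR : 0 < R) (hK : ∀ x ∈ K, x.1 ^ 2 + x.2 ^ 2 < R ^ 2) :
    HasSum (fun n : ℤ => (1 - (n : ℝ) ^ 2) * ‖angleCoeff h n‖ ^ 2) (volume.real K / π) := by
  have hL := H.lipschitzWith hR hK
  have hper : h π = h (-π) := by
    rw [← H.periodic (-π)]; congr 1; ring
  have s1 := hasSum_sq_angleCoeff hL.continuous.measurable fun t => (H.abs_lt hR hK t).le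
  have s2 := hasSum_sq_angleCoeff (measurable_deriv h) fun t =>
    norm_deriv_le_of_lipschitz hL (x₀ := t)
  have e : volume.real K / π = (1 / (2 * π) * ∫ t in (-π)..π, h t ^ 2) -
      1 / (2 * π) * ∫ t in (-π)..π, deriv h t ^ 2 := by
    rw [H.area_eq hR hK]
    field_simp
  have e' : (fun n : ℤ => (1 - (n : ℝ) ^ 2) * ‖angleCoeff h n‖ ^ 2) =
      fun n => ‖angleCoeff h n‖ ^ 2 - ‖angleCoeff (deriv h) n‖ ^ 2 := by
    ext n
    rw [angleCoeff_deriv hL hper, norm_mul, norm_mul, Complex.norm_I, Complex.norm_intCast, one_mul,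
      mul_pow, sq_abs]
    ring
  rw [e, e']
  exact s1.sub s2

theorem angleCoeff_add {f g : ℝ → ℝ} (hf : Continuous f) (hg : Continuous g) (n : ℤ) :
    angleCoeff (fun t => f t + g t) n = angleCoeff f n + angleCoeff g n := by
  simp only [angleCoeff]
  rw [← mul_add, ← intervalIntegral.integral_add
    (Continuous.intervalIntegrable (by fun_prop) _ _)
    (Continuous.intervalIntegrable (by fun_prop) _ _)]
  simp only [Complex.ofReal_add, add_mul]

theorem angleCoeff_comp_add {f : ℝ → ℝ} (hf : Function.Periodic f (2 * π)) (a : ℝ) (n : ℤ) :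
    angleCoeff (fun t => f (t + a)) n = Complex.exp (Complex.I * n * a) * angleCoeff f n := by
  set G : ℝ → ℂ := fun t => (f t : ℂ) * Complex.exp (-(Complex.I * (n : ℂ) * (t : ℂ))) with hG
  have hGp : Function.Periodic G (2 * π) := by
    intro t
    simp only [hG, hf t]
    congr 1
    rw [Complex.exp_eq_exp_iff_exists_int]
    exact ⟨-n, by push_cast; ring⟩
  have e : ∀ t : ℝ, (f (t + a) : ℂ) * Complex.exp (-(Complex.I * (n : ℂ) * (t : ℂ))) =
      Complex.exp (Complex.I * n * a) * G (t + a) := by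
    intro t
    simp only [hG]
    rw [mul_left_comm, ← Complex.exp_add]
    congr 2
    push_cast
    ring
  simp only [angleCoeff, e]
  rw [intervalIntegral.integral_const_mul, intervalIntegral.integral_comp_add_right G a,
    show π + a = (-π + a) + 2 * π by ring, hGp.intervalIntegral_add_eq (-π + a) (-π),
    show -π + 2 * π = π by ring]
  ring

namespace ExcludedArea

theorem inner_unitVec (t : ℝ) (x : Plane) : inner ℝ (unitVec t) x = cos t * x 0 + sin t * x 1 := by
  simp [unitVec, PiLp.inner_apply, Fin.sum_univ_two, mul_comm]

theorem isSupportFunction_of_convex {S : Set Plane} (hS : Convex ℝ S) (hc : IsClosed S) {h : ℝ → ℝ}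
    (hle : ∀ x ∈ S, ∀ t, cos t * x 0 + sin t * x 1 ≤ h t)
    (hex : ∀ t, ∃ x ∈ S, cos t * x 0 + sin t * x 1 = h t) :
    IsSupportFunction {p : ℝ × ℝ | (!₂[p.1, p.2] : Plane) ∈ S} h where
  le p hp t := by simpa using hle _ hp t
  exists_eq t := by
    obtain ⟨x, hx, e⟩ := hex t
    refine ⟨(x 0, x 1), ?_, e⟩
    have : (!₂[x 0, x 1] : Plane) = x := by ext i; fin_cases i <;> rfl
    simpa [this] using hx
  mem p hp := by
    by_contra hn
    obtain ⟨f, u, hf, hu⟩ := geometric_hahn_banach_closed_point hS hc hn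
    set v : Plane := (InnerProductSpace.toDual ℝ Plane).symm f with hv
    have hfv : ∀ x : Plane, f x = v 0 * x 0 + v 1 * x 1 := by
      intro x
      rw [← InnerProductSpace.toDual_symm_apply (𝕜 := ℝ), ← hv]
      simp [PiLp.inner_apply, Fin.sum_univ_two, mul_comm]
    set z : ℂ := ⟨v 0, v 1⟩ with hz
    have h0 : v 0 = ‖z‖ * cos z.arg := (Complex.norm_mul_cos_arg z).symm
    have h1 : v 1 = ‖z‖ * sin z.arg := (Complex.norm_mul_sin_arg z).symm
    obtain ⟨x, hx, e⟩ := hex z.arg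
    have a := hf x hx
    have b := mul_le_mul_of_nonneg_left (hp z.arg) (norm_nonneg z)
    rw [hfv, h0, h1] at a hu
    simp only [Matrix.cons_val_zero, Matrix.cons_val_one] at hu
    rw [← e] at b
    linarith

theorem volume_real_coord (S : Set Plane) (hS : IsClosed S) :
    volume.real {p : ℝ × ℝ | (!₂[p.1, p.2] : Plane) ∈ S} = volume.real S := by
  have hm : MeasurableSet {p : ℝ × ℝ | (!₂[p.1, p.2] : Plane) ∈ S} :=
    (hS.preimage (by fun_prop : Continuous fun p : ℝ × ℝ => (!₂[p.1, p.2] : Plane))).measurableSet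
  rw [measureReal_def, measureReal_def,
    ← measurePreserving_coordProd.measure_preimage hm.nullMeasurableSet]
  congr 2
  ext x
  have : (!₂[x 0, x 1] : Plane) = x := by ext i; fin_cases i <;> rfl
  simp [this]

theorem hasSum_area_of_convex {S : Set Plane} (hS : Convex ℝ S) (hc : IsCompact S) {h : ℝ → ℝ}
    (hle : ∀ x ∈ S, ∀ t, cos t * x 0 + sin t * x 1 ≤ h t)
    (hex : ∀ t, ∃ x ∈ S, cos t * x 0 + sin t * x 1 = h t) :
    HasSum (fun n : ℤ => (1 - (n : ℝ) ^ 2) * ‖angleCoeff h n‖ ^ 2) (volume.real S / π) := by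
  obtain ⟨R, hR, hSR⟩ := hc.isBounded.exists_pos_norm_lt
  rw [← volume_real_coord S hc.isClosed]
  refine (isSupportFunction_of_convex hS hc.isClosed hle hex).hasSum_area hR fun p hp => ?_
  have := hSR _ hp
  rw [EuclideanSpace.norm_eq, Real.sqrt_lt (by positivity) hR.le] at this
  simpa [Fin.sum_univ_two] using this

theorem le_supportAngle (M : ConvexBody Plane) {x : Plane} (hx : x ∈ (M : Set Plane)) (t : ℝ) :
    cos t * x 0 + sin t * x 1 ≤ supportAngle M t := by
  rw [← inner_unitVec]
  exact le_csSup (M.isCompact.image (by fun_prop)).bddAbove ⟨x, hx, rfl⟩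

theorem exists_eq_supportAngle (M : ConvexBody Plane) (t : ℝ) :
    ∃ x ∈ (M : Set Plane), cos t * x 0 + sin t * x 1 = supportAngle M t := by
  obtain ⟨x, hx, e⟩ := M.isCompact.exists_sSup_image_eq M.nonempty
    (f := fun x : Plane => inner ℝ (unitVec t) x) (by fun_prop)
  exact ⟨x, hx, by rw [← inner_unitVec]; exact e.symm⟩

theorem isSupportFunction_supportAngle (M : ConvexBody Plane) :
    IsSupportFunction {p : ℝ × ℝ | (!₂[p.1, p.2] : Plane) ∈ (M : Set Plane)} (supportAngle M) :=
  isSupportFunction_of_convex M.convex M.isClosed (fun _ hx => le_supportAngle M hx)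
    (exists_eq_supportAngle M)

theorem continuous_supportAngle (M : ConvexBody Plane) : Continuous (supportAngle M) := by
  obtain ⟨R, hR, hSR⟩ := M.isCompact.isBounded.exists_pos_norm_lt
  refine ((isSupportFunction_supportAngle M).lipschitzWith hR fun p hp => ?_).continuous
  have := hSR _ hp
  rw [EuclideanSpace.norm_eq, Real.sqrt_lt (by positivity) hR.le] at this
  simpa [Fin.sum_univ_two] using this

theorem isLinearMap_rot (θ : ℝ) : IsLinearMap ℝ (rot θ) where
  map_add x y := by ext i; fin_cases i <;> simp [rot] <;> ring
  map_smul c x := by ext i; fin_cases i <;> simp [rot] <;> ring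

theorem continuous_rot (θ : ℝ) : Continuous (rot θ) := by
  unfold rot
  fun_prop

theorem cos_mul_sub_rot (t θ : ℝ) (x y : Plane) :
    cos t * (x - rot θ y) 0 + sin t * (x - rot θ y) 1 =
      (cos t * x 0 + sin t * x 1) + (cos (t + (π - θ)) * y 0 + sin (t + (π - θ)) * y 1) := by
  rw [show t + (π - θ) = (t - θ) + π by ring, cos_add_pi, sin_add_pi, cos_sub, sin_sub]
  simp [rot]
  ring

theorem hasSum_area_sub_rot (M : ConvexBody Plane) (θ : ℝ) :
    HasSum (fun n : ℤ => (1 - (n : ℝ) ^ 2) *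
      ‖angleCoeff (fun t => supportAngle M t + supportAngle M (t + (π - θ))) n‖ ^ 2)
      (Ex θ M / π) := by
  refine hasSum_area_of_convex
    (M.convex.sub (M.convex.is_linear_image (isLinearMap_rot θ)))
    (sub_eq_add_neg (M : Set Plane) _ ▸
      M.isCompact.add (M.isCompact.image (continuous_rot θ)).neg) ?_ ?_
  · rintro _ ⟨x, hx, _, ⟨y, hy, rfl⟩, rfl⟩ t
    simp only
    rw [cos_mul_sub_rot]
    exact add_le_add (le_supportAngle M hx t) (le_supportAngle M hy _)
  · intro t
    obtain ⟨x, hx, ex⟩ := exists_eq_supportAngle M t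
    obtain ⟨y, hy, ey⟩ := exists_eq_supportAngle M (t + (π - θ))
    exact ⟨_, sub_mem_sub hx (mem_image_of_mem _ hy), by rw [cos_mul_sub_rot, ex, ey]⟩

theorem norm_one_add_exp_sq (n : ℤ) (θ : ℝ) :
    ‖1 + Complex.exp (Complex.I * n * ((π - θ : ℝ) : ℂ))‖ ^ 2 =
      2 * (1 + (-1 : ℝ) ^ n * cos (n * θ)) := by
  rw [show Complex.I * n * ((π - θ : ℝ) : ℂ) = ((n * π - n * θ : ℝ) : ℂ) * Complex.I by
      push_cast; ring, Complex.exp_mul_I, ← Complex.ofReal_cos, ← Complex.ofReal_sin,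
    ← Real.cos_int_mul_pi_sub, ← Complex.normSq_eq_norm_sq, Complex.normSq_apply]
  simp only [Complex.add_re, Complex.add_im, Complex.one_re, Complex.one_im, Complex.ofReal_re,
    Complex.ofReal_im, Complex.mul_re, Complex.mul_im, Complex.I_re, Complex.I_im]
  linear_combination sin_sq_add_cos_sq (n * π - n * θ)

theorem norm_angleCoeff_sub_rot_sq (M : ConvexBody Plane) (θ : ℝ) (n : ℤ) :
    ‖angleCoeff (fun t => supportAngle M t + supportAngle M (t + (π - θ))) n‖ ^ 2 =
      2 * (1 + (-1 : ℝ) ^ n * cos (n * θ)) * ‖supportCoeff M n‖ ^ 2 := by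
  have hc := continuous_supportAngle M
  rw [angleCoeff_add hc (by fun_prop),
    angleCoeff_comp_add (isSupportFunction_supportAngle M).periodic, ← one_add_mul, norm_mul,
    mul_pow, norm_one_add_exp_sq]
  rfl

end ExcludedArea

theorem mainTheorem2 (M : ConvexBody ExcludedArea.Plane) (θ : ℝ) :
    Summable (fun n : ℤ =>
      (1 - (n : ℝ) ^ 2) * (1 + (-1 : ℝ) ^ n * Real.cos ((n : ℝ) * θ)) *
        ‖ExcludedArea.supportCoeff M n‖ ^ 2) ∧
    ExcludedArea.Ex θ M =
      2 * Real.pi * ∑' n : ℤ,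
        (1 - (n : ℝ) ^ 2) * (1 + (-1 : ℝ) ^ n * Real.cos ((n : ℝ) * θ)) *
          ‖ExcludedArea.supportCoeff M n‖ ^ 2 := by
  have hs : HasSum (fun n : ℤ =>
      (1 - (n : ℝ) ^ 2) * (1 + (-1 : ℝ) ^ n * Real.cos ((n : ℝ) * θ)) *
        ‖ExcludedArea.supportCoeff M n‖ ^ 2) (1 / 2 * (ExcludedArea.Ex θ M / π)) := by
    have := (ExcludedArea.hasSum_area_sub_rot M θ).mul_left (1 / 2)
    simp only [ExcludedArea.norm_angleCoeff_sub_rot_sq] at this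
    rwa [show (fun n : ℤ => 1 / 2 * ((1 - (n : ℝ) ^ 2) *
        (2 * (1 + (-1 : ℝ) ^ n * cos (n * θ)) * ‖ExcludedArea.supportCoeff M n‖ ^ 2))) = fun n : ℤ =>
        (1 - (n : ℝ) ^ 2) * (1 + (-1 : ℝ) ^ n * Real.cos ((n : ℝ) * θ)) *
        ‖ExcludedArea.supportCoeff M n‖ ^ 2 from funext fun n => by ring] at this
  refine ⟨hs.summable, ?_⟩
  rw [hs.tsum_eq]
  field_simp
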